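/- Let $X$ be a continuum, that is, a nonempty compact connected metric space. Let $2^X$ be the space of nonempty closed subsets of $X$ with the Hausdorff metric, and let $C(X)\subset 2^X$ be the subspace of connected sets. An order arc in $C(X)$ is a continuous map $\alpha:[0,1]\to C(X)$ with $\alpha(s)\subsetneq\alpha(t)$ whenever $0\le s<t\le 1$. A set $A\in 2^X$ with $A\neq X$ is a nonblocker (of singletons) of $X$ if for every $x\in X\setminus A$ there is an order arc $\alpha:[0,1]\to C(X)$ such that $\alpha(0)=\{x\}$, $\alpha(1)=X$ and $\alpha(t)\cap A=\emptyset$ for all $t\in[0,1)$. For $a\in X$, let $\pi(a)$ be the intersection of all nonblockers of $X$ that contain $a$ if there are any, and let $\pi(a)=X$ otherwise. Let $B(a)$ be the set of all $x\in X$ such that $\{a\}$ blocks $\{x\}$, that is, such that for every continuous map $\gamma:[0,1]\to 2^X$ with $\gamma(0)=\{x\}$ and $\gamma(1)=X$ there is a $t<1$ with $a\in\gamma(t)$. If $X$ is homogeneous (for all $p,q\in X$ there is a homeomorphism $h:X\to X$ with $h(p)=q$) and $X$ has at least one nonblocker, then $\pi(x)=B(x)$ for every $x\in X$. -/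

import Mathlib

open TopologicalSpace Set

namespace Continua

/-- The hyperspace `2^X` of nonempty closed subsets of a compact metric space `X`, with the Hausdorff
metric. As `X` is compact, these are the nonempty compact subsets of `X`. -/
abbrev Hyp (X : Type*) [MetricSpace X] : Type _ := NonemptyCompacts X

/-- The hyperspace `C(X)` of subcontinua of `X`, as a subspace of `2^X`. -/
abbrev SubCont (X : Type*) [MetricSpace X] : Type _ := {A : Hyp X // IsConnected (A : Set X)}

/-- A space is homogeneous if its homeomorphisms act transitively on its points. -/
def Homogeneous (X : Type*) [TopologicalSpace X] : Prop :=
  ∀ p q : X, ∃ h : X ≃ₜ X, h p = q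

variable {X : Type*} [MetricSpace X]

/-- An order arc in `C(X)`: a continuous, strictly increasing map from `[0,1]` to `C(X)`. -/
def IsOrderArc (α : unitInterval → SubCont X) : Prop :=
  Continuous α ∧ ∀ s t, s < t → ((α s).1 : Set X) ⊂ ((α t).1 : Set X)

/-- The nonblockers of `X`: the sets `A ∈ 2^X`, other than `X`, such that every point `x` outside `A`
is joined to `X` by an order arc in `C(X)` that avoids `A` before time `1`. -/
def nonblockers (X : Type*) [MetricSpace X] : Set (Hyp X) :=
  {A | (A : Set X) ≠ univ ∧ ∀ x : X, x ∉ A →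
    ∃ α : unitInterval → SubCont X, IsOrderArc α ∧
      ((α 0).1 : Set X) = {x} ∧ ((α 1).1 : Set X) = univ ∧
      ∀ t < 1, ((α t).1 : Set X) ∩ A = ∅}

/-- `B` blocks `A`: every path in `2^X` from `A` to `X` meets `B` before time `1`. -/
def Blocks (B A : Hyp X) : Prop :=
  ∀ γ : unitInterval → Hyp X, Continuous γ → γ 0 = A → (γ 1 : Set X) = univ →
    ∃ t < 1, ((γ t : Set X) ∩ B).Nonempty

/-- The blocked set `B(a)`: the points `x` such that `{a}` blocks `{x}`. -/
def blockedSet (a : X) : Set X :=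
  {x | Blocks ({a} : Hyp X) ({x} : Hyp X)}

/-- The nonblockers of `X` that contain `a`. -/
def nonblockersAt (a : X) : Set (Hyp X) :=
  {A | A ∈ nonblockers X ∧ a ∈ A}

open Classical in
/-- `π(a)`: the intersection of all nonblockers that contain `a` if there are any, and `X` if not. -/
noncomputable def minNonblocker (a : X) : Set X :=
  if (nonblockersAt a).Nonempty then ⋂ A ∈ nonblockersAt a, (A : Set X) else univ

end Continua

/-!
Let `D S y` be the union of all continua that contain `y` and miss `S`. Boundary bumping and a
Whitney map turn every chain of continua through `y` into an order arc from `{y}` to `X`, so for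
nonempty `S` the density of `D S y` is equivalent to the existence of such an arc, and of any path
in the hyperspace, that avoids `S` before its end. Thus `A ≠ X` is a nonblocker iff `D A x` is dense
for all `x ∉ A`, and `x ∈ B(a)` iff `D {a} x` is not dense.

On a compact homogeneous space an invariant preorder with closed upper sets is symmetric: by
compactness it has a maximal element, and by homogeneity every element is then maximal. This applies
first to `b ∈ π(a)`. Since `B(a) ⊆ π(a)`, the symmetry of `π` shows that `{a | y ∈ B(a)}` is closed,
so the principle also applies to `B`. Hence `B(a)` is closed, therefore a nonblocker containing `a`,
and `π(a) ⊆ B(a)`.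
-/

namespace Continua

section OrderArc

theorem ordConnected_of_isCompact {α : Type*} [LinearOrder α] [TopologicalSpace α]
    [OrderClosedTopology α] {s : Set α} [DenselyOrdered s] (hs : IsCompact s) : OrdConnected s := by
  refine ⟨fun a ha b hb c hc => ?_⟩
  by_contra hcs
  obtain ⟨k, ⟨hks, hkc⟩, hk⟩ := (hs.inter_right (isClosed_Iic (a := c))).exists_isGreatest
    ⟨a, ha, hc.1⟩
  obtain ⟨l, ⟨hls, hcl⟩, hl⟩ := (hs.inter_right (isClosed_Ici (a := c))).exists_isLeast
    ⟨b, hb, hc.2⟩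
  have hkc : k < c := lt_of_le_of_ne hkc (ne_of_mem_of_not_mem hks hcs)
  have hcl : c < l := lt_of_le_of_ne hcl (ne_of_mem_of_not_mem hls hcs).symm
  obtain ⟨⟨m, hms⟩, hkm, hml⟩ :=
    exists_between (show (⟨k, hks⟩ : s) < ⟨l, hls⟩ from hkc.trans hcl)
  rcases le_total m c with hmc | hcm
  · exact (hk ⟨hms, hmc⟩).not_gt hkm
  · exact (hl ⟨hms, hcm⟩).not_gt hml

theorem exists_continuous_orderIso_unitInterval {Y : Type*} [LinearOrder Y] [BoundedOrder Y]
    [DenselyOrdered Y] [Nontrivial Y] [TopologicalSpace Y] [CompactSpace Y] {ν : Y → ℝ}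
    (hν : Continuous ν) (hmono : StrictMono ν) : ∃ e : unitInterval ≃o Y, Continuous e := by
  have hpos : 0 < ν ⊤ - ν ⊥ := sub_pos.2 (hmono bot_lt_top)
  let μ : Y → ℝ := fun y => (ν y - ν ⊥) / (ν ⊤ - ν ⊥)
  have hμ : Continuous μ := (hν.sub continuous_const).div_const _
  have hμmono : StrictMono μ := fun x y hxy =>
    div_lt_div_of_pos_right (sub_lt_sub_right (hmono hxy) _) hpos
  have hbot : μ ⊥ = 0 := by simp [μ]
  have htop : μ ⊤ = 1 := div_self hpos.ne'
  have hrange : range μ = unitInterval := by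
    have := hμmono.denselyOrdered_range
    refine Subset.antisymm ?_ ?_
    · rintro _ ⟨y, rfl⟩
      exact ⟨hbot ▸ hμmono.monotone bot_le, htop ▸ hμmono.monotone le_top⟩
    · exact (ordConnected_of_isCompact (isCompact_range hμ)).out ⟨⊥, hbot⟩ ⟨⊤, htop⟩
  let e : Y ≃o unitInterval := (hμmono.orderIso μ).trans (OrderIso.setCongr _ _ hrange)
  have he : Continuous e := hμ.subtype_mk _
  exact ⟨e.symm, (he.homeoOfEquivCompactToT2 (f := e.toEquiv)).symm.continuous⟩

theorem isClosed_flag {Y : Type*} [PartialOrder Y] [TopologicalSpace Y] [OrderClosedTopology Y]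
    (s : Flag Y) : IsClosed (s : Set Y) := by
  have hs : (s : Set Y) = ⋂ b ∈ s, Iic b ∪ Ici b := by
    ext a
    rw [SetLike.mem_coe, Flag.mem_iff_forall_le_or_ge]
    simp only [mem_iInter, mem_union, mem_Iic, mem_Ici]
  rw [hs]
  exact isClosed_biInter fun b _ => isClosed_Iic.union isClosed_Ici

theorem denselyOrdered_flag {Y : Type*} [PartialOrder Y] [DenselyOrdered Y] (s : Flag Y) :
    DenselyOrdered s := by
  refine ⟨?_⟩
  rintro ⟨a, ha⟩ ⟨b, hb⟩ (hab : a < b)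
  by_contra! hgap
  obtain ⟨m, ham, hmb⟩ := exists_between hab
  have hms : m ∈ s := Flag.mem_iff_forall_le_or_ge.2 fun c hc => by
    rcases s.le_or_le hc ha with hca | hac
    · exact .inr (hca.trans ham.le)
    rcases s.le_or_le hc hb with hcb | hbc
    · rcases hac.eq_or_lt with rfl | hac
      · exact .inr ham.le
      rcases hcb.eq_or_lt with rfl | hcb
      · exact .inl hmb.le
      exact (hgap ⟨c, hc⟩ hac hcb).elim
    · exact .inl (hmb.le.trans hbc)
  exact hgap ⟨m, hms⟩ ham hmb

/-- An order arc in a bounded partially ordered space that runs from the least to the greatest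
element. The order arcs of the hyperspace that run from `{y}` to `X` are of this kind in the space
of subcontinua that contain `y`. -/
structure IsSpanningOrderArc {Y : Type*} [PartialOrder Y] [BoundedOrder Y] [TopologicalSpace Y]
    (α : unitInterval → Y) : Prop where
  continuous : Continuous α
  strictMono : StrictMono α
  map_zero : α 0 = ⊥
  map_one : α 1 = ⊤

theorem exists_isSpanningOrderArc_of_isChain {Y : Type*} [PartialOrder Y] [BoundedOrder Y]
    [DenselyOrdered Y] [Nontrivial Y] [TopologicalSpace Y] [CompactSpace Y] [OrderClosedTopology Y]
    {ν : Y → ℝ} (hν : Continuous ν) (hmono : StrictMono ν) {C : Set Y} (hC : IsChain (· ≤ ·) C) :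
    ∃ α : unitInterval → Y, IsSpanningOrderArc α ∧ ∀ t, ∀ c ∈ C, α t ≤ c ∨ c ≤ α t := by
  classical
  obtain ⟨s, hCs⟩ := hC.exists_subset_flag
  have := denselyOrdered_flag s
  have : CompactSpace s := isCompact_iff_compactSpace.1 (isClosed_flag s).isCompact
  have : Nontrivial s := ⟨⊥, ⊤, fun h => bot_ne_top (congrArg Subtype.val h)⟩
  obtain ⟨e, he⟩ := exists_continuous_orderIso_unitInterval (Y := s)
    (hν.comp continuous_subtype_val) (fun _ _ h => hmono h)
  refine ⟨fun t => e t, ⟨continuous_subtype_val.comp he, fun _ _ h => e.strictMono h, ?_, ?_⟩,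
    fun t c hc => s.le_or_le (e t).2 (hCs hc)⟩
  · exact congrArg Subtype.val e.map_bot
  · exact congrArg Subtype.val e.map_top

end OrderArc

section BoundaryBumping

theorem isClosed_connectedComponentIn {X : Type*} [TopologicalSpace X] {F : Set X}
    (hF : IsClosed F) (x : X) : IsClosed (connectedComponentIn F x) := by
  by_cases hx : x ∈ F
  · rw [connectedComponentIn_eq_image hx]
    exact hF.isClosedMap_subtype_val _ isClosed_connectedComponent
  · rw [connectedComponentIn_eq_empty hx]
    exact isClosed_empty

variable {X : Type*} [TopologicalSpace X] [CompactSpace X] [T2Space X]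

theorem exists_isClopen_of_connectedComponent_subset {x : X} {U : Set X} (hU : IsOpen U)
    (hxU : connectedComponent x ⊆ U) : ∃ Z, IsClopen Z ∧ x ∈ Z ∧ Z ⊆ U := by
  rw [connectedComponent_eq_iInter_isClopen] at hxU
  have : Nonempty {s : Set X // IsClopen s ∧ x ∈ s} := ⟨⟨univ, isClopen_univ, mem_univ x⟩⟩
  obtain ⟨Z, hZU⟩ := exists_subset_nhds_of_isCompact
    (V := fun s : {s : Set X // IsClopen s ∧ x ∈ s} => (s : Set X))
    (fun s t => ⟨⟨s ∩ t, s.2.1.inter t.2.1, s.2.2, t.2.2⟩, inter_subset_left, inter_subset_right⟩)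
    (fun s => s.2.1.isClosed.isCompact) (fun y hy => hU.mem_nhds (hxU hy))
  exact ⟨Z, Z.2.1, Z.2.2, hZU⟩

/-- The boundary bumping theorem. -/
theorem not_connectedComponentIn_subset_interior [PreconnectedSpace X] {F : Set X}
    (hF : IsClosed F) (hne : F ≠ univ) {x : X} (hx : x ∈ F) :
    ¬ connectedComponentIn F x ⊆ interior F := by
  intro hsub
  have : CompactSpace F := isCompact_iff_compactSpace.1 hF.isCompact
  rw [connectedComponentIn_eq_image hx, image_subset_iff] at hsub
  obtain ⟨Z, hZ, hxZ, hZF⟩ := exists_isClopen_of_connectedComponent_subset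
    (isOpen_interior.preimage continuous_subtype_val) hsub
  obtain ⟨O, hO, rfl⟩ := isOpen_induced_iff.1 hZ.isOpen
  have himage : F ∩ O = interior F ∩ O :=
    Subset.antisymm (fun z hz => ⟨@hZF ⟨z, hz.1⟩ hz.2, hz.2⟩)
      (inter_subset_inter_left O interior_subset)
  have hclopen : IsClopen (F ∩ O) := by
    refine ⟨?_, himage ▸ isOpen_interior.inter hO⟩
    rw [← Subtype.image_preimage_coe]
    exact hF.isClosedMap_subtype_val _ hZ.isClosed
  have huniv : F ∩ O = univ := hclopen.eq_univ ⟨x, hx, hxZ⟩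
  exact hne (univ_subset_iff.1 (huniv ▸ inter_subset_left))

theorem exists_isConnected_ssuperset_ne_univ [PreconnectedSpace X] {K : Set X} (hK : IsClosed K)
    (hKc : IsConnected K) (hne : K ≠ univ) :
    ∃ M, IsClosed M ∧ IsConnected M ∧ K ⊂ M ∧ M ≠ univ := by
  obtain ⟨p, hp⟩ := (ne_univ_iff_exists_notMem K).1 hne
  obtain ⟨k, hk⟩ := hKc.nonempty
  obtain ⟨U, V, hU, hV, hKU, hpV, hUV⟩ := normal_separation hK (isClosed_singleton (x := p))
    (disjoint_singleton_right.2 hp)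
  rw [singleton_subset_iff] at hpV
  have hUF : U ⊆ interior Vᶜ := interior_maximal (subset_compl_iff_disjoint_right.2 hUV) hU
  have hKF : K ⊆ Vᶜ := (hKU.trans hUF).trans interior_subset
  have hM := connectedComponentIn_subset Vᶜ k
  refine ⟨connectedComponentIn Vᶜ k, isClosed_connectedComponentIn hV.isClosed_compl k,
    isConnected_connectedComponentIn_iff.2 (hKF hk),
    ⟨hKc.isPreconnected.subset_connectedComponentIn hk hKF, fun hMK => ?_⟩,
    fun h => hM (h ▸ mem_univ p) hpV⟩
  exact not_connectedComponentIn_subset_interior hV.isClosed_compl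
    (fun h => (h ▸ mem_univ p : p ∈ Vᶜ) hpV) (hKF hk) (hMK.trans (hKU.trans hUF))

end BoundaryBumping

theorem exists_isConnected_between {X : Type*} [TopologicalSpace X] [T2Space X] {K L : Set X}
    (hK : IsCompact K) (hKc : IsConnected K) (hL : IsCompact L) (hLc : IsConnected L)
    (hKL : K ⊂ L) : ∃ M, IsCompact M ∧ IsConnected M ∧ K ⊂ M ∧ M ⊂ L := by
  have : CompactSpace L := isCompact_iff_compactSpace.1 hL
  have : ConnectedSpace L := isConnected_iff_connectedSpace.1 hLc
  have himage : ((↑) : L → X) '' ((↑) ⁻¹' K) = K := by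
    rw [Subtype.image_preimage_coe, inter_eq_right.2 hKL.1]
  have hconn : IsConnected (((↑) : L → X) ⁻¹' K) := by
    refine ⟨image_nonempty.1 (himage ▸ hKc.nonempty), ?_⟩
    rw [← Topology.IsInducing.subtypeVal.isPreconnected_image, himage]
    exact hKc.isPreconnected
  obtain ⟨M, hM, hMc, hKM, hne⟩ := exists_isConnected_ssuperset_ne_univ
    (hK.isClosed.preimage continuous_subtype_val) hconn fun h => hKL.2 fun x hx =>
      (h ▸ mem_univ (⟨x, hx⟩ : L) : (⟨x, hx⟩ : L) ∈ ((↑) : L → X) ⁻¹' K)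
  have hinj := Subtype.val_injective.image_strictMono (β := X) (α := L)
  refine ⟨(↑) '' M, hM.isCompact.image continuous_subtype_val,
    hMc.image _ continuous_subtype_val.continuousOn, himage ▸ hinj hKM, ?_⟩
  simpa only [image_univ, Subtype.range_coe] using hinj (ssubset_univ_iff.2 hne)

section Hyperspace

instance {X : Type*} [TopologicalSpace X] [T2Space X] :
    OrderClosedTopology (NonemptyCompacts X) where
  isClosed_le' := by
    simp only [← sup_eq_right]
    exact isClosed_eq (continuous_fst.sup continuous_snd) continuous_snd

theorem isClosed_setOf_isConnected {X : Type*} [TopologicalSpace X] [T2Space X] :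
    IsClosed {K : NonemptyCompacts X | IsConnected (K : Set X)} := by
  rw [← isOpen_compl_iff, isOpen_iff_mem_nhds]
  intro K hK
  have hK' : ¬ IsPreconnected (K : Set X) := fun h => hK ⟨K.nonempty, h⟩
  rw [isPreconnected_iff_subset_of_fully_disjoint_closed K.isCompact.isClosed] at hK'
  push Not at hK'
  obtain ⟨u, v, hu, hv, huv, hd, hnu, hnv⟩ := hK'
  obtain ⟨U, V, hU, hV, hKU, hKV, hUV⟩ := SeparatedNhds.of_isCompact_isCompact
    (K.isCompact.inter_right hu) (K.isCompact.inter_right hv)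
    (hd.mono inter_subset_right inter_subset_right)
  have hcover : ∀ᶠ L : NonemptyCompacts X in nhds K, (L : Set X) ⊆ U ∪ V :=
    (NonemptyCompacts.isOpen_subsets_of_isOpen (hU.union hV)).mem_nhds fun x hx =>
      (huv hx).imp (fun h => hKU ⟨hx, h⟩) fun h => hKV ⟨hx, h⟩
  have hmeetU : ∀ᶠ L : NonemptyCompacts X in nhds K, ((L : Set X) ∩ U).Nonempty := by
    obtain ⟨x, hx, hxv⟩ := not_subset.1 hnv
    exact (NonemptyCompacts.isOpen_inter_nonempty_of_isOpen hU).mem_nhds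
      ⟨x, hx, hKU ⟨hx, (huv hx).resolve_right hxv⟩⟩
  have hmeetV : ∀ᶠ L : NonemptyCompacts X in nhds K, ((L : Set X) ∩ V).Nonempty := by
    obtain ⟨x, hx, hxu⟩ := not_subset.1 hnu
    exact (NonemptyCompacts.isOpen_inter_nonempty_of_isOpen hV).mem_nhds
      ⟨x, hx, hKV ⟨hx, (huv hx).resolve_left hxu⟩⟩
  filter_upwards [hcover, hmeetU, hmeetV] with L hLUV hLU hLV hL
  obtain ⟨x, -, hxU, hxV⟩ := hL.isPreconnected U V hU hV hLUV hLU hLV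
  exact disjoint_left.1 hUV hxU hxV

section Whitney

variable {X : Type*} [MetricSpace X] [SeparableSpace X] [Nonempty X]

/-- A Whitney map: a continuous, strictly increasing real function on the hyperspace. Only these two
properties matter here, so it is not normalized to vanish on singletons. -/
noncomputable def whitneyMap (K : NonemptyCompacts X) : ℝ :=
  -∑' n : ℕ, (1 / 2 : ℝ) ^ n * min 1 (Metric.infDist (denseSeq X n) (K : Set X))

theorem norm_whitneyMap_term_le (n : ℕ) (K : NonemptyCompacts X) :
    ‖(1 / 2 : ℝ) ^ n * min 1 (Metric.infDist (denseSeq X n) (K : Set X))‖ ≤ (1 / 2 : ℝ) ^ n := by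
  have hmin : 0 ≤ min 1 (Metric.infDist (denseSeq X n) (K : Set X)) :=
    le_min zero_le_one Metric.infDist_nonneg
  rw [Real.norm_of_nonneg (by positivity)]
  exact mul_le_of_le_one_right (by positivity) (min_le_left _ _)

theorem continuous_whitneyMap : Continuous (whitneyMap (X := X)) := by
  refine (continuous_tsum (fun n => ?_) summable_geometric_two norm_whitneyMap_term_le).neg
  exact continuous_const.mul (continuous_const.min (Metric.lipschitz_infDist_set _).continuous)

theorem exists_infDist_denseSeq_lt {K L : NonemptyCompacts X} (hKL : K < L) :
    ∃ n, Metric.infDist (denseSeq X n) (L : Set X) <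
      min 1 (Metric.infDist (denseSeq X n) (K : Set X)) := by
  obtain ⟨p, hpL, hpK⟩ := SetLike.exists_of_lt hKL
  have hpos : 0 < Metric.infDist p (K : Set X) :=
    (K.isCompact.isClosed.notMem_iff_infDist_pos K.nonempty).1 hpK
  obtain ⟨n, hn⟩ := (denseRange_denseSeq X).exists_dist_lt p (lt_min (half_pos hpos) one_pos)
  rw [lt_min_iff] at hn
  have hnL : Metric.infDist (denseSeq X n) (L : Set X) ≤ dist p (denseSeq X n) :=
    dist_comm p _ ▸ Metric.infDist_le_dist_of_mem hpL
  have hnK := Metric.infDist_le_infDist_add_dist (s := (K : Set X)) (x := p) (y := denseSeq X n)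
  exact ⟨n, lt_min (by linarith) (by linarith)⟩

theorem strictMono_whitneyMap : StrictMono (whitneyMap (X := X)) := by
  intro K L hKL
  have hsum (K : NonemptyCompacts X) : Summable fun n : ℕ =>
      (1 / 2 : ℝ) ^ n * min 1 (Metric.infDist (denseSeq X n) (K : Set X)) :=
    .of_norm_bounded summable_geometric_two (norm_whitneyMap_term_le · K)
  obtain ⟨n, hn⟩ := exists_infDist_denseSeq_lt hKL
  refine neg_lt_neg ((hsum L).tsum_lt_tsum (i := n) (fun m => ?_) ?_ (hsum K))
  · gcongr
    exact Metric.infDist_le_infDist_of_subset hKL.le K.nonempty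
  · gcongr
    exact (min_le_right _ _).trans_lt hn

end Whitney

end Hyperspace

section SubContAt

variable {X : Type*} [TopologicalSpace X]

/-- The space of subcontinua of `X` that contain `y`, ordered by inclusion. -/
abbrev SubContAt (y : X) : Type _ :=
  {K : NonemptyCompacts X // IsConnected (K : Set X) ∧ y ∈ K}

variable (y : X)

instance : SemilatticeSup (SubContAt y) :=
  Subtype.semilatticeSup fun K L hK hL => ⟨by
    rw [NonemptyCompacts.coe_sup]
    exact hK.1.union ⟨y, hK.2, hL.2⟩ hL.1, Or.inl hK.2⟩

instance [CompactSpace X] [T2Space X] : CompactSpace (SubContAt y) := by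
  have hmem := NonemptyCompacts.isClosed_inter_nonempty_of_isClosed (isClosed_singleton (x := y))
  simp only [inter_singleton_nonempty, SetLike.mem_coe] at hmem
  exact isCompact_iff_compactSpace.1 (isClosed_setOf_isConnected.inter hmem).isCompact

instance [CompactSpace X] [ConnectedSpace X] : BoundedOrder (SubContAt y) where
  bot := ⟨{y}, by simpa using isConnected_singleton, by simp⟩
  bot_le K := show (({y} : NonemptyCompacts X) : Set X) ⊆ K.1 by simpa using K.2.2
  top := ⟨⊤, by simpa using isConnected_univ, mem_univ y⟩
  le_top K := subset_univ (K.1 : Set X)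

instance [Nontrivial X] [CompactSpace X] [ConnectedSpace X] : Nontrivial (SubContAt y) := by
  obtain ⟨x, hx⟩ := exists_ne y
  refine ⟨⊥, ⊤, fun h => hx ?_⟩
  have hmem : x ∈ (⊤ : SubContAt y).1 := mem_univ x
  rwa [← h] at hmem

instance [T2Space X] : DenselyOrdered (SubContAt y) where
  dense K L hKL := by
    obtain ⟨M, hM, hMc, hKM, hML⟩ := exists_isConnected_between K.1.isCompact K.2.1 L.1.isCompact
      L.2.1 (show (K.1 : Set X) ⊂ L.1 from hKL)
    exact ⟨⟨⟨⟨M, hM⟩, hMc.nonempty⟩, hMc, hKM.1 K.2.2⟩, hKM, hML⟩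

variable {y} [CompactSpace X] [ConnectedSpace X] {α : unitInterval → SubContAt y}

theorem IsSpanningOrderArc.coe_zero (hα : IsSpanningOrderArc α) : ((α 0).1 : Set X) = {y} := by
  rw [hα.map_zero]
  rfl

theorem IsSpanningOrderArc.coe_one (hα : IsSpanningOrderArc α) : ((α 1).1 : Set X) = univ := by
  rw [hα.map_one]
  rfl

end SubContAt

section ContinuumComponent

variable {X : Type*} [TopologicalSpace X]

/-- The continuum component of `y` off `S`: the union of all continua that contain `y` and are
disjoint from `S`. It is empty if `y ∈ S`. -/
def continuumComponent (S : Set X) (y : X) : Set X :=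
  {z | ∃ K : SubContAt y, z ∈ K.1 ∧ Disjoint (K.1 : Set X) S}

variable {S T : Set X} {y z : X}

theorem continuumComponent_symm (h : z ∈ continuumComponent S y) : y ∈ continuumComponent S z :=
  let ⟨K, hz, hd⟩ := h
  ⟨⟨K.1, K.2.1, hz⟩, K.2.2, hd⟩

theorem continuumComponent_subset_of_mem (h : z ∈ continuumComponent S y) :
    continuumComponent S z ⊆ continuumComponent S y := by
  obtain ⟨K, hz, hKS⟩ := h
  rintro w ⟨L, hw, hLS⟩
  refine ⟨K ⊔ ⟨K.1 ⊔ L.1, ?_, .inl K.2.2⟩, .inr (.inr hw), ?_⟩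
  · rw [NonemptyCompacts.coe_sup]
    exact K.2.1.union ⟨z, hz, L.2.2⟩ L.2.1
  · exact hKS.union_left (hKS.union_left hLS)

theorem continuumComponent_anti (h : S ⊆ T) :
    continuumComponent T y ⊆ continuumComponent S y :=
  fun _ ⟨K, hz, hd⟩ => ⟨K, hz, hd.mono_right h⟩

theorem image_continuumComponent_subset (h : X ≃ₜ X) (S : Set X) (y : X) :
    h '' continuumComponent S y ⊆ continuumComponent (h '' S) (h y) := by
  rintro _ ⟨z, ⟨K, hz, hd⟩, rfl⟩
  refine ⟨⟨K.1.map h h.continuous, ?_, mem_image_of_mem h K.2.2⟩, mem_image_of_mem h hz, ?_⟩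
  · rw [NonemptyCompacts.coe_map]
    exact K.2.1.image h h.continuous.continuousOn
  · rw [NonemptyCompacts.coe_map]
    exact (disjoint_image_iff h.injective).2 hd

theorem dense_continuumComponent_image (h : X ≃ₜ X) (hd : Dense (continuumComponent S y)) :
    Dense (continuumComponent (h '' S) (h y)) :=
  (h.surjective.denseRange.dense_image h.continuous hd).mono
    (image_continuumComponent_subset h S y)

section Path

variable {γ : unitInterval → NonemptyCompacts X}

theorem dense_of_forall_lt_one_subset {D : Set X} (hγ : Continuous γ) (h1 : (γ 1 : Set X) = univ)
    (hD : ∀ t < 1, (γ t : Set X) ⊆ D) : Dense D := by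
  have hclosed : IsClosed {t | (γ t : Set X) ⊆ closure D} :=
    (NonemptyCompacts.isClosed_subsets_of_isClosed isClosed_closure).preimage hγ
  have hmem : (1 : unitInterval) ∈ closure (Iio 1) := by
    rw [closure_Iio' ⟨0, zero_lt_one⟩]
    exact self_mem_Iic
  have hsub : (γ 1 : Set X) ⊆ closure D :=
    closure_minimal (fun t ht => (hD t ht).trans subset_closure) hclosed hmem
  exact fun x => hsub (h1 ▸ mem_univ x)

theorem isCompact_biUnion_Iic (hγ : Continuous γ) (t : unitInterval) :
    IsCompact (⋃ s ∈ Iic t, (γ s : Set X)) := by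
  have := NonemptyCompacts.isCompact_biUnion_coe_of_isCompact 
    ((isClosed_Iic (a := t)).isCompact.image hγ)
  rwa [biUnion_image] at this

theorem isPreconnected_biUnion_Iic (hγ : Continuous γ) (h0 : IsPreconnected (γ 0 : Set X))
    (t : unitInterval) : IsPreconnected (⋃ s ∈ Iic t, (γ s : Set X)) := by
  let : TopologicalSpace (Set X) := .vietoris X
  exact vietoris.isPreconnected_biUnion ordConnected_Iic.isPreconnected
    (NonemptyCompacts.continuous_coe.comp hγ).continuousOn ⟨0, t.2.1, h0⟩

theorem subset_continuumComponent_of_path (hγ : Continuous γ) (h0 : (γ 0 : Set X) = {y})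
    (hS : ∀ t < 1, Disjoint (γ t : Set X) S) {t : unitInterval} (ht : t < 1) :
    (γ t : Set X) ⊆ continuumComponent S y := by
  have hsub : ∀ s ≤ t, (γ s : Set X) ⊆ ⋃ s ∈ Iic t, (γ s : Set X) :=
    fun s hs => subset_biUnion_of_mem (u := fun s => (γ s : Set X)) hs
  have hy : y ∈ ⋃ s ∈ Iic t, (γ s : Set X) := hsub 0 t.2.1 (h0 ▸ mem_singleton y)
  have hconn := isPreconnected_biUnion_Iic hγ (h0 ▸ isPreconnected_singleton) t
  refine fun z hz => ⟨⟨⟨⟨_, isCompact_biUnion_Iic hγ t⟩, y, hy⟩, ⟨⟨y, hy⟩, hconn⟩, hy⟩,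
    hsub t le_rfl hz, ?_⟩
  exact disjoint_iUnion₂_left.2 fun s hs => hS s (lt_of_le_of_lt hs ht)

theorem dense_continuumComponent_of_path (hγ : Continuous γ) (h0 : (γ 0 : Set X) = {y})
    (h1 : (γ 1 : Set X) = univ) (hS : ∀ t < 1, Disjoint (γ t : Set X) S) :
    Dense (continuumComponent S y) :=
  dense_of_forall_lt_one_subset hγ h1 fun _ => subset_continuumComponent_of_path hγ h0 hS

end Path

theorem exists_monotone_dense_iUnion [SecondCountableTopology X]
    (hd : Dense (continuumComponent S y)) :
    ∃ K : ℕ → SubContAt y, Monotone K ∧ (∀ n, Disjoint ((K n).1 : Set X) S) ∧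
      Dense (⋃ n, ((K n).1 : Set X)) := by
  have : Nonempty X := ⟨y⟩
  have := hd.nonempty.to_subtype
  choose L hL hdis using fun n => (denseSeq (continuumComponent S y) n).2
  refine ⟨partialSups L, (partialSups L).monotone, fun n => ?_, ?_⟩
  · refine (partialSups_iff_forall (fun K : SubContAt y => Disjoint (K.1 : Set X) S) ?_).2
      fun m _ => hdis m
    exact disjoint_sup_left
  · refine Dense.mono ?_ (hd.denseRange_val.comp (denseRange_denseSeq _) continuous_subtype_val)
    rintro _ ⟨n, rfl⟩
    exact mem_iUnion.2 ⟨n, le_partialSups L n (hL n)⟩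

end ContinuumComponent

section Homogeneous

variable {Y : Type*} [TopologicalSpace Y] [CompactSpace Y] {R : Y → Y → Prop}

theorem exists_forall_rel_symm_of_isClosed [Nonempty Y] (hrefl : ∀ x, R x x)
    (htrans : ∀ {x y z}, R x y → R y z → R x z) (hcl : ∀ x, IsClosed {y | R x y}) :
    ∃ m, ∀ y, R m y → R y m := by
  refine exists_maximal_of_chains_bounded (fun c hc => ?_) htrans
  rcases c.eq_empty_or_nonempty with rfl | hne
  · exact ⟨Classical.arbitrary Y, by simp⟩
  have := hne.to_subtype
  have : Std.Refl R := ⟨hrefl⟩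
  have hdir : Directed (· ⊇ ·) fun a : c => {y | R a y} := fun a b => by
    rcases hc.total a.2 b.2 with hab | hba
    · exact ⟨b, fun _ => htrans hab, Subset.rfl⟩
    · exact ⟨a, Subset.rfl, fun _ => htrans hba⟩
  obtain ⟨z, hz⟩ := IsCompact.nonempty_iInter_of_directed_nonempty_isCompact_isClosed _ hdir
    (fun a => ⟨a, hrefl a⟩) (fun a => (hcl a).isCompact) fun a => hcl a
  exact ⟨z, fun a ha => mem_iInter.1 hz ⟨a, ha⟩⟩

theorem rel_symm_of_homogeneous (hom : Homogeneous Y) (hrefl : ∀ x, R x x)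
    (htrans : ∀ {x y z}, R x y → R y z → R x z) (hcl : ∀ x, IsClosed {y | R x y})
    (hinv : ∀ (h : Y ≃ₜ Y) {x y}, R x y → R (h x) (h y)) {x y : Y} (hxy : R x y) : R y x := by
  have : Nonempty Y := ⟨x⟩
  obtain ⟨m, hm⟩ := exists_forall_rel_symm_of_isClosed hrefl htrans hcl
  obtain ⟨h, rfl⟩ := hom m x
  have hmy : R m (h.symm y) := by simpa only [h.symm_apply_apply] using hinv h.symm hxy
  simpa only [h.apply_symm_apply] using hinv h (hm _ hmy)

end Homogeneous

section MinNonblocker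

variable {X : Type*} [MetricSpace X] {a x : X}

theorem mem_minNonblocker_iff :
    x ∈ minNonblocker a ↔ ∀ A ∈ nonblockers X, a ∈ A → x ∈ A := by
  unfold minNonblocker
  split_ifs with hne
  · simp [nonblockersAt]
  · exact iff_of_true (mem_univ x) fun A hA ha => (hne ⟨A, hA, ha⟩).elim

theorem minNonblocker_subset {A : Hyp X} (hA : A ∈ nonblockers X) (ha : a ∈ A) :
    minNonblocker a ⊆ A :=
  fun _ hx => mem_minNonblocker_iff.1 hx A hA ha

theorem minNonblocker_ne_univ (hne : (nonblockersAt a).Nonempty) : minNonblocker a ≠ univ := by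
  obtain ⟨A, hA, ha⟩ := hne
  exact fun h => hA.1 (univ_subset_iff.1 (h ▸ minNonblocker_subset hA ha))

theorem isClosed_minNonblocker (a : X) : IsClosed (minNonblocker a) := by
  have hπ : minNonblocker a = ⋂ A ∈ nonblockersAt a, (A : Set X) := by
    ext x
    simp [mem_minNonblocker_iff, nonblockersAt]
  rw [hπ]
  exact isClosed_biInter fun A _ => A.isCompact.isClosed

end MinNonblocker

theorem self_mem_blockedSet {X : Type*} [MetricSpace X] (a : X) : a ∈ blockedSet a :=
  fun γ _ h0 _ => ⟨0, zero_lt_one, by rw [h0]; exact ⟨a, rfl, rfl⟩⟩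

variable {X : Type*} [MetricSpace X] [CompactSpace X] [ConnectedSpace X]

theorem exists_isSpanningOrderArc_of_dense {S : Set X} {y : X} (hS : S.Nonempty)
    (hd : Dense (continuumComponent S y)) :
    ∃ α : unitInterval → SubContAt y, IsSpanningOrderArc α ∧
      ∀ t < 1, Disjoint ((α t).1 : Set X) S := by
  obtain ⟨s, hs⟩ := hS
  obtain ⟨z, K₀, -, hK₀⟩ := hd.nonempty
  have : Nontrivial X := ⟨y, s, fun h => disjoint_left.1 hK₀ K₀.2.2 (h ▸ hs)⟩
  obtain ⟨K, hK, hdis, hdense⟩ := exists_monotone_dense_iUnion hd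
  obtain ⟨α, hα, hcomp⟩ := exists_isSpanningOrderArc_of_isChain
    (ν := fun K : SubContAt y => whitneyMap K.1)
    (continuous_whitneyMap.comp continuous_subtype_val) (fun _ _ h => strictMono_whitneyMap h)
    hK.isChain_range
  refine ⟨α, hα, fun t ht => ?_⟩
  by_cases h : ∃ n, α t ≤ K n
  · obtain ⟨n, hn⟩ := h
    exact (hdis n).mono_left hn
  · push Not at h
    have hle : ∀ n, K n ≤ α t := fun n => (hcomp t _ ⟨n, rfl⟩).resolve_left (h n)
    have htop : ⊤ ≤ α t := fun x _ =>
      closure_minimal (iUnion_subset hle) (α t).1.isCompact.isClosed (hdense x)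
    exact absurd (hα.strictMono ht) (hα.map_one ▸ htop).not_gt

theorem mem_nonblockers_iff {A : Hyp X} : A ∈ nonblockers X ↔
    (A : Set X) ≠ univ ∧ ∀ x ∉ A, Dense (continuumComponent (A : Set X) x) := by
  refine and_congr_right fun _ => forall₂_congr fun x _ => ⟨?_, fun hd => ?_⟩
  · rintro ⟨α, hα, h0, h1, hdis⟩
    exact dense_continuumComponent_of_path (γ := fun t => (α t).1)
      (continuous_subtype_val.comp hα.1) h0 h1 fun t ht => disjoint_iff_inter_eq_empty.2 (hdis t ht)
  · obtain ⟨α, hα, hdis⟩ := exists_isSpanningOrderArc_of_dense A.nonempty hd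
    exact ⟨fun t => ⟨(α t).1, (α t).2.1⟩, ⟨(continuous_subtype_val.comp hα.continuous).subtype_mk _,
      fun _ _ hst => hα.strictMono hst⟩, hα.coe_zero, hα.coe_one, fun t ht => (hdis t ht).inter_eq⟩

theorem mem_blockedSet_iff {a x : X} :
    x ∈ blockedSet a ↔ ¬ Dense (continuumComponent {a} x) := by
  constructor
  · intro hb hd
    obtain ⟨α, hα, hdis⟩ := exists_isSpanningOrderArc_of_dense (singleton_nonempty a) hd
    obtain ⟨t, ht, hmeet⟩ := hb (fun t => (α t).1) (continuous_subtype_val.comp hα.continuous)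
      (SetLike.coe_injective (by simpa using hα.coe_zero)) hα.coe_one
    rw [NonemptyCompacts.coe_singleton, ← not_disjoint_iff_nonempty_inter] at hmeet
    exact hmeet (hdis t ht)
  · intro hd γ hγ h0 h1
    by_contra! hdis
    refine hd (dense_continuumComponent_of_path hγ (by simp [h0]) h1 fun t ht => ?_)
    rw [disjoint_iff_inter_eq_empty, ← NonemptyCompacts.coe_singleton, hdis t ht]

section BlockedSet

variable {a b x y : X}

theorem blockedSet_trans (hxa : x ∈ blockedSet a) (hab : a ∈ blockedSet b) :
    x ∈ blockedSet b := by
  rw [mem_blockedSet_iff] at *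
  intro hd
  by_cases ha : a ∈ continuumComponent {b} x
  · exact hab (hd.mono (continuumComponent_subset_of_mem (continuumComponent_symm ha)))
  · refine hxa (hd.mono ?_)
    rintro z ⟨K, hz, hdis⟩
    exact ⟨K, hz, disjoint_singleton_right.2 fun haK => ha ⟨K, haK, hdis⟩⟩

theorem image_mem_blockedSet (h : X ≃ₜ X) (hx : x ∈ blockedSet a) : h x ∈ blockedSet (h a) := by
  rw [mem_blockedSet_iff] at *
  intro hd
  refine hx ?_
  simpa only [image_singleton, Homeomorph.symm_apply_apply] using
    dense_continuumComponent_image h.symm hd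

theorem disjoint_continuumComponent_blockedSet (hy : y ∉ blockedSet a) :
    Disjoint (continuumComponent {a} y) (blockedSet a) := by
  rw [mem_blockedSet_iff, not_not] at hy
  exact disjoint_left.2 fun z hz hza => mem_blockedSet_iff.1 hza
    (hy.mono (continuumComponent_subset_of_mem (continuumComponent_symm hz)))

theorem mem_nonblockers_of_coe_eq_blockedSet {A : Hyp X} (hA : (A : Set X) = blockedSet a)
    (hne : blockedSet a ≠ univ) : A ∈ nonblockers X := by
  refine mem_nonblockers_iff.2 ⟨hA ▸ hne, fun y hy => ?_⟩
  rw [← SetLike.mem_coe, hA] at hy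
  have hdis := disjoint_continuumComponent_blockedSet hy
  rw [mem_blockedSet_iff, not_not] at hy
  refine hy.mono ?_
  rintro z ⟨K, hz, hd⟩
  have hKD : (K.1 : Set X) ⊆ continuumComponent {a} y := fun w hw => ⟨K, hw, hd⟩
  exact ⟨K, hz, hA ▸ hdis.mono_left hKD⟩

theorem blockedSet_subset_of_mem_nonblockers {A : Hyp X} (hA : A ∈ nonblockers X) (ha : a ∈ A) :
    blockedSet a ⊆ A := by
  intro x hx
  by_contra hxA
  exact mem_blockedSet_iff.1 hx (((mem_nonblockers_iff.1 hA).2 x hxA).mono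
    (continuumComponent_anti (singleton_subset_iff.2 ha)))

end BlockedSet

theorem blockedSet_subset_minNonblocker (a : X) : blockedSet a ⊆ minNonblocker a :=
  fun _ hx => mem_minNonblocker_iff.2 fun _ hA ha => blockedSet_subset_of_mem_nonblockers hA ha hx

theorem dense_continuumComponent_minNonblocker {a x : X} (hx : x ∉ minNonblocker a) :
    Dense (continuumComponent (minNonblocker a) x) := by
  rw [mem_minNonblocker_iff] at hx
  push Not at hx
  obtain ⟨A, hA, ha, hxA⟩ := hx
  exact ((mem_nonblockers_iff.1 hA).2 x hxA).mono
    (continuumComponent_anti (minNonblocker_subset hA ha))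

theorem map_mem_nonblockers (h : X ≃ₜ X) {A : Hyp X} (hA : A ∈ nonblockers X) :
    A.map h h.continuous ∈ nonblockers X := by
  obtain ⟨hne, hA⟩ := mem_nonblockers_iff.1 hA
  refine mem_nonblockers_iff.2 ⟨fun heq => hne ?_, fun x hx => ?_⟩
  · rw [NonemptyCompacts.coe_map] at heq
    rw [← h.preimage_image A, heq, preimage_univ]
  · obtain ⟨w, rfl⟩ := h.surjective x
    rw [NonemptyCompacts.coe_map]
    exact dense_continuumComponent_image h (hA w fun hw => hx (mem_image_of_mem h hw))

theorem image_mem_minNonblocker (h : X ≃ₜ X) {a b : X} (hb : b ∈ minNonblocker a) :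
    h b ∈ minNonblocker (h a) := by
  refine mem_minNonblocker_iff.2 fun A hA ha => ?_
  obtain ⟨w, hw, rfl⟩ := minNonblocker_subset (map_mem_nonblockers h.symm hA)
    ⟨h a, ha, h.symm_apply_apply a⟩ hb
  rwa [h.apply_symm_apply]

theorem minNonblocker_symm (hom : Homogeneous X) {a b : X} (h : b ∈ minNonblocker a) :
    a ∈ minNonblocker b := by
  refine rel_symm_of_homogeneous (R := fun a b => b ∈ minNonblocker a) hom ?_ ?_
    isClosed_minNonblocker image_mem_minNonblocker h
  · exact fun x => mem_minNonblocker_iff.2 fun A _ hx => hx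
  · simp only [mem_minNonblocker_iff]
    exact fun hxy hyz A hA hx => hyz A hA (hxy A hA hx)

theorem isClosed_setOf_mem_blockedSet (hom : Homogeneous X) {y : X}
    (hn : (nonblockersAt y).Nonempty) : IsClosed {a | y ∈ blockedSet a} := by
  rw [← isOpen_compl_iff, isOpen_iff_mem_nhds]
  intro a ha
  have hd : Dense (continuumComponent {a} y) := by simpa [mem_blockedSet_iff] using ha
  obtain ⟨z, ⟨K, hzK, hdis⟩, hzπ⟩ : ∃ z ∈ continuumComponent {a} y, z ∉ minNonblocker y :=
    not_subset.1 fun h => minNonblocker_ne_univ hn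
      (univ_subset_iff.1 fun x _ => closure_minimal h (isClosed_minNonblocker y) (hd x))
  filter_upwards [K.1.isCompact.isClosed.isOpen_compl.mem_nhds (disjoint_singleton_right.1 hdis)]
    with b hbK hb
  have hbπ : b ∈ minNonblocker y := minNonblocker_symm hom (blockedSet_subset_minNonblocker b hb)
  have hzy : z ∈ continuumComponent {b} y := ⟨K, hzK, disjoint_singleton_right.2 hbK⟩
  exact mem_blockedSet_iff.1 hb ((dense_continuumComponent_minNonblocker hzπ).mono
    ((continuumComponent_anti (singleton_subset_iff.2 hbπ)).trans
      (continuumComponent_subset_of_mem hzy)))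

theorem nonblockersAt_nonempty (hom : Homogeneous X) (hne : (nonblockers X).Nonempty) (a : X) :
    (nonblockersAt a).Nonempty := by
  obtain ⟨A, hA⟩ := hne
  obtain ⟨b, hb⟩ := A.nonempty
  obtain ⟨h, rfl⟩ := hom b a
  exact ⟨_, map_mem_nonblockers h hA, mem_image_of_mem h hb⟩

theorem blockedSet_symm (hom : Homogeneous X) (hne : (nonblockers X).Nonempty) {a b : X}
    (h : b ∈ blockedSet a) : a ∈ blockedSet b :=
  rel_symm_of_homogeneous (R := fun x y => x ∈ blockedSet y) hom self_mem_blockedSet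
    blockedSet_trans
    (fun y => isClosed_setOf_mem_blockedSet hom (nonblockersAt_nonempty hom hne y))
    (fun e _ _ => image_mem_blockedSet e) h

theorem isClosed_blockedSet (hom : Homogeneous X) (hne : (nonblockers X).Nonempty) (a : X) :
    IsClosed (blockedSet a) := by
  have hB : blockedSet a = {b | a ∈ blockedSet b} :=
    Set.ext fun _ => ⟨blockedSet_symm hom hne, blockedSet_symm hom hne⟩
  rw [hB]
  exact isClosed_setOf_mem_blockedSet hom (nonblockersAt_nonempty hom hne a)

end Continua

theorem mainTheorem6 {X : Type*} [MetricSpace X] [CompactSpace X] [ConnectedSpace X]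
    (hom : Continua.Homogeneous X) (hne : (Continua.nonblockers X).Nonempty) :
    ∀ x : X, Continua.minNonblocker x = Continua.blockedSet x := by
  intro a
  have hsub := Continua.blockedSet_subset_minNonblocker a
  have hproper : Continua.blockedSet a ≠ univ := fun h =>
    Continua.minNonblocker_ne_univ (Continua.nonblockersAt_nonempty hom hne a)
      (univ_subset_iff.1 (h ▸ hsub))
  have ha : a ∈ Continua.blockedSet a := Continua.self_mem_blockedSet a
  let A : Continua.Hyp X :=
    ⟨⟨Continua.blockedSet a, (Continua.isClosed_blockedSet hom hne a).isCompact⟩, ⟨a, ha⟩⟩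
  have hA : A ∈ Continua.nonblockers X :=
    Continua.mem_nonblockers_of_coe_eq_blockedSet rfl hproper
  exact (Continua.minNonblocker_subset hA ha).antisymm hsub
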